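/- Let $\xi=\{\xi_1,\xi_2\}$ be a basis of $\mathbb R^2$, let $\Lambda=\mathbb Z\xi_1+\mathbb Z\xi_2$, $C_\xi=[0,\xi_1]\oplus[0,\xi_2]$, let $n\in\mathbb N$ and $C=\{j_1\xi_1+j_2\xi_2 \mid j_1,j_2\in\{0,\dots,n-1\}\}$. A local estimator for $V_0$ is given by weights $w_B(a)\in\mathbb R$ for $a>0$ and $\emptyset\ne B\subseteq C$ such that $w_{B_1}(a)=w_{B_2}(a)$ whenever $R(B_1+z_1)=B_2+z_2$ for some $z_1,z_2\in\mathbb R^2$ and some linear isometry $R$ with $R\Lambda=\Lambda$. Its value on the digital image of $X\subseteq\mathbb R^2$ in the lattice $a(\Lambda+c)$ is $$\hat V_0^{a,c}(X)=\sum_{\emptyset\neq B\subseteq C} w_B(a)\cdot\#\{z\in\Lambda \mid a(B+z+c)\subseteq X,\ a((C\setminus B)+z+c)\subseteq \mathbb R^2\setminus X\},$$ and $E\hat V_0^{a}(X)$ denotes its mean when $c$ is uniformly distributed in $C_\xi$. The estimator is homogeneous of degree $0$ if $w_B(a)=w_B(1)$ for all $a>0$. Let $\mathcal P^2$ be the class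 of compact convex polygons with non-empty interior, and let $V_0$ be the intrinsic volume of degree $0$ (so $V_0(P)=1$ for $P\in\mathcal P^2$). For every local estimator for $V_0$ the following holds. (i) $c\mapsto\hat V_0^{a,c}(P)$ is integrable over $C_\xi$ for all $a>0$ and $P\in\mathcal P^2$, and the worst case asymptotic relative bias on $\mathcal P^2$ is at least $1$: $$\sup_{P\in\mathcal P^2}\ \limsup_{a\to0^+}\frac{|E\hat V_0^{a}(P)-V_0(P)|}{V_0(P)}\ \ge\ 1 .$$ (Where $\lim_{a\to 0^+}E\hat V_0^{a}(P)$ exists, the upper limit is a limit. In particular, if it exists for all $P\in\mathcal P^2$, then $\sup_{P}|\lim_{a\to0^+}E\hat V_0^{a}(P)-V_0(P)|/V_0(P)\ge1$.) (ii) Write $v(\theta)=(\cos\theta,\sin\theta)$ and let $$P(\varphi,\psi,s_1,s_2)=[0,s_1v(\varphi)]\oplus[0,s_2v(\varphi+\psi)].$$ Let $I=(p,q)\subseteq\mathbb R$ be a bounded open interval such that no $v(\theta)$, $\theta\in I$, is of the form $z/|z|$ with $0\neq z=k_1\xi_1+k_2\xi_2$, $k_1,k_2\in\{-n,\dots,n-1\}$.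 Suppose that $$L(\varphi,\psi,s_1,s_2)=\lim_{a\to0^+}E\hat V_0^{a}(P(\varphi,\psi,s_1,s_2))$$ exists whenever $\varphi,\varphi+\psi\in I$, $0<\psi<\pi$ and $s_1,s_2>0$. Then for all such $(\varphi,\psi,s_1,s_2)$ the limit $L_0(\varphi,\psi)=\lim_{t\to0^+}L(\varphi,\psi,ts_1,ts_2)$ exists and does not depend on $s_1,s_2$; if the estimator is homogeneous of degree $0$, then $L(\varphi,\psi,s_1,s_2)=L_0(\varphi,\psi)$. Moreover, either $L_0(\varphi,\psi)=0$ for all $\varphi,\psi$ with $\varphi,\varphi+\psi\in I$ and $0<\psi<\pi$, or there is a $\varphi\in I$ with $\lim_{\psi\to0^+}L_0(\varphi,\psi)=+\infty$ or $\lim_{\psi\to0^+}L_0(\varphi,\psi)=-\infty$. -/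

import Mathlib

open Set Filter Topology MeasureTheory
open scoped Pointwise ENNReal

/-- The Euclidean plane. -/
abbrev Plane : Type := EuclideanSpace ℝ (Fin 2)

/-- The class `𝓟²`: convex hulls of finitely many points, with non-empty interior. -/
def IsConvexPolygon (P : Set Plane) : Prop :=
  (∃ s : Finset Plane, P = convexHull ℝ (s : Set Plane)) ∧ (interior P).Nonempty

/-- The intrinsic volume `V₀` of a compact convex set in the plane: the coefficient of `κ₂ r² = π r²`
in the Steiner polynomial `r ↦ area (X ⊕ B(r)) = V₂(X) + 2 r V₁(X) + π r² V₀(X)`, read off as its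
normalised leading coefficient (see `intrinsicVolumeZero_eq_of_steiner`). -/
noncomputable def intrinsicVolumeZero (X : Set Plane) : ℝ :=
  limUnder atTop
    (fun r : ℝ => (volume : Measure Plane).real (X + Metric.closedBall 0 r) / (Real.pi * r ^ 2))

/-- `intrinsicVolumeZero` is the coefficient `V₀` of the Steiner formula. -/
theorem intrinsicVolumeZero_eq_of_steiner (X : Set Plane) (V₀ V₁ V₂ : ℝ)
    (h : ∀ r : ℝ, 0 < r → (volume : Measure Plane).real (X + Metric.closedBall 0 r)
      = V₂ + 2 * r * V₁ + Real.pi * r ^ 2 * V₀) :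
    intrinsicVolumeZero X = V₀ := by
  refine Tendsto.limUnder_eq ?_
  have hinv : Tendsto (fun r : ℝ => r⁻¹) atTop (𝓝 0) := tendsto_inv_atTop_zero
  have h1 : Tendsto (fun r : ℝ =>
      V₂ / Real.pi * (r⁻¹ * r⁻¹) + 2 * V₁ / Real.pi * r⁻¹ + V₀) atTop
      (𝓝 (V₂ / Real.pi * (0 * 0) + 2 * V₁ / Real.pi * 0 + V₀)) :=
    (((hinv.mul hinv).const_mul _).add (hinv.const_mul _)).add tendsto_const_nhds
  have h2 : V₂ / Real.pi * (0 * 0) + 2 * V₁ / Real.pi * 0 + V₀ = V₀ := by ring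
  rw [h2] at h1
  refine h1.congr' ?_
  filter_upwards [eventually_gt_atTop (0 : ℝ)] with r hr
  rw [h r hr]
  have hpi := Real.pi_ne_zero
  field_simp

/-- The point `∑ᵢ kᵢ ξᵢ` of the lattice spanned by `ξ`. -/
noncomputable def latticePoint (ξ : Module.Basis (Fin 2) ℝ Plane) (k : Fin 2 → ℤ) : Plane :=
  ∑ i, (k i : ℝ) • ξ i

/-- The lattice `Λ` spanned by `ξ`. -/
def planeLattice (ξ : Module.Basis (Fin 2) ℝ Plane) : Set Plane :=
  range (latticePoint ξ)

/-- The lattice point with coordinates `j` in the fundamental `n × n` cell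
`{∑ᵢ jᵢ ξᵢ | jᵢ ∈ {0, …, n - 1}}`. -/
noncomputable def pixel (ξ : Module.Basis (Fin 2) ℝ Plane) {n : ℕ} (j : Fin 2 → Fin n) : Plane :=
  latticePoint ξ (fun i => ((j i : ℕ) : ℤ))

/-- The `n × n` configurations `(B, W)`, encoded by the set `B` of (coordinates of) black pixels.
The set `W` of white pixels is the complement of `B` in the fundamental `n × n` cell. -/
abbrev Configuration (n : ℕ) : Type := Finset (Fin 2 → Fin n)

/-- The set of black pixels of a configuration, as a subset of the lattice. -/
def blackPixels (ξ : Module.Basis (Fin 2) ℝ Plane) {n : ℕ} (B : Configuration n) : Set Plane :=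
  pixel ξ '' (B : Set (Fin 2 → Fin n))

/-- The number of occurrences of the configuration `(B, W)` in the digital image of `X` on the
lattice `a (Λ + c)`: the number of `z ∈ Λ` with `a (B + z + c) ⊆ X` and `a (W + z + c) ∩ X = ∅`. -/
noncomputable def configurationCount (ξ : Module.Basis (Fin 2) ℝ Plane) {n : ℕ}
    (B : Configuration n) (a : ℝ) (c : Plane) (X : Set Plane) : ℕ :=
  Set.ncard {k : Fin 2 → ℤ |
    (∀ j, j ∈ B → a • (pixel ξ j + latticePoint ξ k + c) ∈ X) ∧
    (∀ j, j ∉ B → a • (pixel ξ j + latticePoint ξ k + c) ∉ X)}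

/-- A local digital estimator for `V₀` based on `n × n` configurations in the lattice spanned by `ξ`:
weights `w_B(a)`, depending on the lattice distance `a > 0` and on the configuration,
invariant under all translations and all rotations and reflections preserving the lattice. -/
structure LocalEstimator (ξ : Module.Basis (Fin 2) ℝ Plane) (n : ℕ) where
  /-- the weights `w_B(a)` -/
  weight : ℝ → Configuration n → ℝ
  /-- motion and reflection invariance -/
  invariant : ∀ (R : Plane ≃ₗᵢ[ℝ] Plane), R '' planeLattice ξ = planeLattice ξ →
    ∀ (B₁ B₂ : Configuration n) (z₁ z₂ : Plane),
      R '' ((fun x => x + z₁) '' blackPixels ξ B₁) = (fun x => x + z₂) '' blackPixels ξ B₂ →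
      ∀ a : ℝ, 0 < a → weight a B₁ = weight a B₂

namespace LocalEstimator

variable {ξ : Module.Basis (Fin 2) ℝ Plane} {n : ℕ}

/-- The value of the estimator on the digital image `X ∩ a (Λ + c)`. The sum is over all
configurations with at least one black pixel. -/
noncomputable def estimate (est : LocalEstimator ξ n) (a : ℝ) (c : Plane) (X : Set Plane) : ℝ :=
  ∑ B : Configuration n with B.Nonempty, est.weight a B * (configurationCount ξ B a c X : ℝ)

/-- The mean of the estimator when `c` is uniformly distributed in the unit cell `[0,ξ₁] ⊕ [0,ξ₂]`. -/
noncomputable def mean (est : LocalEstimator ξ n) (a : ℝ) (X : Set Plane) : ℝ :=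
  ⨍ c in parallelepiped ξ, est.estimate a c X

/-- The weights are homogeneous of degree `q`. -/
def IsHomogeneous (est : LocalEstimator ξ n) (q : ℕ) : Prop :=
  ∀ a : ℝ, 0 < a → ∀ B : Configuration n, B.Nonempty → est.weight a B = a ^ q * est.weight 1 B

/-- The asymptotic relative bias `|lim_{a → 0} E V̂₀(X) - V₀(X)| / V₀(X)` at `X`. It is written with an
upper limit, which is the limit whenever that exists (see `asymptoticBias_eq_of_tendsto`). -/
noncomputable def asymptoticBias (est : LocalEstimator ξ n) (X : Set Plane) : ℝ≥0∞ :=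
  limsup (fun a : ℝ =>
    ENNReal.ofReal (|est.mean a X - intrinsicVolumeZero X| / intrinsicVolumeZero X)) (𝓝[>] 0)

theorem asymptoticBias_eq_of_tendsto (est : LocalEstimator ξ n) (X : Set Plane) (l : ℝ)
    (h : Tendsto (fun a : ℝ => est.mean a X) (𝓝[>] 0) (𝓝 l)) :
    est.asymptoticBias X
      = ENNReal.ofReal (|l - intrinsicVolumeZero X| / intrinsicVolumeZero X) :=
  Tendsto.limsup_eq ((ENNReal.continuous_ofReal.tendsto _).comp
    ((h.sub_const _).abs.div_const _))

/-- The worst case asymptotic relative bias on the class of convex polygons. -/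
noncomputable def worstCaseBias (est : LocalEstimator ξ n) : ℝ≥0∞ :=
  ⨆ (P : Set Plane) (_ : IsConvexPolygon P), est.asymptoticBias P

end LocalEstimator

/-- The unit vector `(cos θ, sin θ)`. -/
noncomputable def unitVector (θ : ℝ) : Plane := !₂[Real.cos θ, Real.sin θ]

/-- The parallelogram `P(φ, ψ, s₁, s₂) = [0, s₁ v₁] ⊕ [0, s₂ v₂]`, where `v₁` and `v₂` are the unit
vectors with polar angles `φ` and `φ + ψ`. -/
noncomputable def parallelogram (φ ψ s₁ s₂ : ℝ) : Set Plane :=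
  segment ℝ 0 (s₁ • unitVector φ) + segment ℝ 0 (s₂ • unitVector (φ + ψ))

/-- The finite set `D_Λ` of directions `z / |z|` of the non-zero lattice points `z = k₁ ξ₁ + k₂ ξ₂`
with `-n ≤ kᵢ < n`. -/
def latticeDirections (ξ : Module.Basis (Fin 2) ℝ Plane) (n : ℕ) : Set Plane :=
  {v | ∃ k : Fin 2 → ℤ, (∀ i, -(n : ℤ) ≤ k i ∧ k i < (n : ℤ)) ∧ k ≠ 0 ∧
    v = ‖latticePoint ξ k‖⁻¹ • latticePoint ξ k}

/-! Möbius inversion turns the weights into coefficients `coeff a S` for which the estimator counts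
only translates of `S` contained in `X`, with no condition on white pixels. Averaging over `c`
replaces each count by the area of `hitSet ξ S a X`, up to the cell area `V` (`mean_eq_sum_coeff`).

For a parallelogram with both edge directions in `I`, this area is explicit. No direction in `I` is
parallel to a difference of two pixels, so the order of the pixels under `perp θ` is the same for
all `θ ∈ I`, and the width of `S` is `perp θ (D S)` with a vector `D S` independent of `θ`. For
small `a` the hit set is again a parallelogram, so the mean is a polynomial of bidegree (1, 1) in
`(s₁, s₂)` with constant term `cornerForm D a φ (φ + ψ) / (V sin ψ)` (`mean_parallelogram`).

Convergence for all `s₁, s₂` forces each coefficient to converge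
(`tendsto_coeff_of_tendsto_bilinear`). The corner form is a symmetric bilinear form in two unit
vectors, and so is its limit. That limit either vanishes identically or is non-zero at some diagonal
point of `I × I` (`eq_zero_or_tendsto_diagonal`); in the second case division by `sin ψ` makes `L₀`
blow up. Neither alternative lets `L₀` stay in an interval `[1 - δ, 1 + δ]` with `δ < 1`, which
gives the bias bound. -/

/-! ### Möbius inversion over finite subsets -/

section Moebius

variable {ι : Type*} [DecidableEq ι]

/-- The Möbius transform of a function on finite sets. -/
noncomputable def moebiusTransform (G : Finset ι → ℝ) (T : Finset ι) : ℝ :=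
  G T - ∑ S ∈ T.ssubsets.attach, moebiusTransform G S
termination_by T.card
decreasing_by exact Finset.card_lt_card (Finset.mem_ssubsets.1 S.2)

theorem sum_powerset_moebiusTransform (G : Finset ι → ℝ) (T : Finset ι) :
    ∑ S ∈ T.powerset, moebiusTransform G S = G T := by
  rw [← Finset.insert_erase (Finset.mem_powerset_self T)]
  rw [Finset.sum_insert (Finset.notMem_erase _ _), moebiusTransform,
    Finset.sum_attach T.ssubsets (fun S => moebiusTransform G S)]
  simp [Finset.ssubsets]

theorem moebiusTransform_empty (G : Finset ι → ℝ) : moebiusTransform G ∅ = G ∅ := by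
  simpa using sum_powerset_moebiusTransform G ∅

end Moebius

/-! ### Averages of lattice point counts over a cell -/

section Estimator

variable {ξ : Module.Basis (Fin 2) ℝ Plane} {n : ℕ}

theorem latticePoint_injective (ξ : Module.Basis (Fin 2) ℝ Plane) :
    Function.Injective (latticePoint ξ) := by
  intro k l h
  have h2 := ξ.linearIndependent
  rw [Fintype.linearIndependent_iff] at h2
  have h3 := h2 (fun i => (k i : ℝ) - l i) (by
    simp only [sub_smul, Finset.sum_sub_distrib]
    exact sub_eq_zero.2 h)
  ext i
  have := sub_eq_zero.1 (h3 i)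
  exact_mod_cast this

/-- The coordinates of the points of the lattice. -/
noncomputable def latticeEquiv (ξ : Module.Basis (Fin 2) ℝ Plane) :
    (Fin 2 → ℤ) ≃ Submodule.span ℤ (range ξ) :=
  (ξ.restrictScalars ℤ).equivFun.symm.toEquiv

theorem coe_latticeEquiv (k : Fin 2 → ℤ) : (latticeEquiv ξ k : Plane) = latticePoint ξ k := by
  simp [latticeEquiv, latticePoint, Module.Basis.equivFun_symm_apply, Int.cast_smul_eq_zsmul]

theorem finite_latticePoint_mem {X : Set Plane} (hX : Bornology.IsBounded X) :
    {k : Fin 2 → ℤ | latticePoint ξ k ∈ X}.Finite := by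
  have h := ZSpan.setFinite_inter ξ hX
  refine Set.Finite.of_finite_image (f := latticePoint ξ) (h.subset ?_)
    (latticePoint_injective ξ).injOn
  rintro _ ⟨k, hk, rfl⟩
  exact ⟨hk, by rw [← coe_latticeEquiv]; exact (latticeEquiv ξ k).2⟩

/-- The number of lattice translates of `c` lying in `E`. -/
theorem ncard_eq_toReal_tsum (E : Set Plane) (c : Plane) :
    (({k : Fin 2 → ℤ | latticePoint ξ k + c ∈ E}.ncard : ℕ) : ℝ)
      = (∑' k : Fin 2 → ℤ, E.indicator (1 : Plane → ℝ≥0∞) (latticePoint ξ k + c)).toReal := by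
  have h1 : ∑' k : Fin 2 → ℤ, E.indicator (1 : Plane → ℝ≥0∞) (latticePoint ξ k + c)
      = {k : Fin 2 → ℤ | latticePoint ξ k + c ∈ E}.encard := by
    rw [← ENNReal.tsum_set_one]
    exact (tsum_subtype {k : Fin 2 → ℤ | latticePoint ξ k + c ∈ E} (fun _ => (1 : ℝ≥0∞))).symm
  rw [h1, Set.ncard]
  -- For an infinite set both `ncard` and `toReal ∞` take the default value 0, so no finiteness is
  -- needed.
  cases h : {k : Fin 2 → ℤ | latticePoint ξ k + c ∈ E}.encard <;> simp

/-- The lattice translates of the cell tile the plane. The closed parallelepiped differs from the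
half-open fundamental domain by a null set. -/
theorem lintegral_tsum_indicator {E : Set Plane} (hE : MeasurableSet E) :
    ∫⁻ c in parallelepiped ξ,
      ∑' k : Fin 2 → ℤ, E.indicator (1 : Plane → ℝ≥0∞) (latticePoint ξ k + c) = volume E := by
  have hm : Measurable (E.indicator (1 : Plane → ℝ≥0∞)) := measurable_one.indicator hE
  rw [lintegral_tsum (fun k => by
    exact (hm.comp (measurable_const_add _)).aemeasurable)]
  have : VAddInvariantMeasure (Submodule.span ℤ (range ξ)) Plane volume :=
    inferInstanceAs <|
      VAddInvariantMeasure (Submodule.span ℤ (range ξ)).toAddSubgroup Plane volume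
  have h := (ZSpan.isAddFundamentalDomain ξ (volume : Measure Plane)).lintegral_eq_tsum''
    (E.indicator (1 : Plane → ℝ≥0∞))
  rw [lintegral_indicator_one hE] at h
  rw [h, ← (latticeEquiv ξ).tsum_eq]
  refine tsum_congr fun k => ?_
  rw [setLIntegral_congr (ZSpan.fundamentalDomain_ae_parallelepiped ξ volume)]
  refine lintegral_congr fun c => ?_
  rw [← coe_latticeEquiv]
  rfl

theorem measurable_tsum_indicator {E : Set Plane} (hE : MeasurableSet E) :
    Measurable (fun c => ∑' k : Fin 2 → ℤ,
      E.indicator (1 : Plane → ℝ≥0∞) (latticePoint ξ k + c)) :=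
  Measurable.tsum fun _ => (measurable_one.indicator hE).comp (measurable_const_add _)

theorem integrableOn_ncard {E : Set Plane} (hE : MeasurableSet E) (hfin : volume E ≠ ∞) :
    IntegrableOn (fun c => (({k : Fin 2 → ℤ | latticePoint ξ k + c ∈ E}.ncard : ℕ) : ℝ))
      (parallelepiped ξ) := by
  simp only [ncard_eq_toReal_tsum]
  refine integrable_toReal_of_lintegral_ne_top (measurable_tsum_indicator hE).aemeasurable ?_
  rwa [lintegral_tsum_indicator hE]

theorem integral_ncard {E : Set Plane} (hE : MeasurableSet E) (hfin : volume E ≠ ∞) :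
    ∫ c in parallelepiped ξ, (({k : Fin 2 → ℤ | latticePoint ξ k + c ∈ E}.ncard : ℕ) : ℝ)
      = volume.real E := by
  simp only [ncard_eq_toReal_tsum]
  rw [integral_toReal (measurable_tsum_indicator hE).aemeasurable, lintegral_tsum_indicator hE,
    measureReal_def]
  refine ae_lt_top (measurable_tsum_indicator hE) ?_
  rwa [lintegral_tsum_indicator hE]

/-! ### The mean as a combination of areas of hit sets -/

/-- The `x` such that the translate by `x` of the pixels in `S`, scaled by `a`, lies in `X`. -/
def hitSet (ξ : Module.Basis (Fin 2) ℝ Plane) (S : Configuration n) (a : ℝ) (X : Set Plane) :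
    Set Plane :=
  {x | ∀ j ∈ S, a • (pixel ξ j + x) ∈ X}

theorem isBounded_preimage_smul_add {X : Set Plane} (hX : Bornology.IsBounded X) {a : ℝ}
    (ha : 0 < a) (b : Plane) : Bornology.IsBounded {x | a • (b + x) ∈ X} := by
  have h1 : Bornology.IsBounded (a⁻¹ • X + {-b}) := (hX.smul₀ _).add Bornology.isBounded_singleton
  refine h1.subset fun x hx => ?_
  refine Set.mem_add.2 ⟨b + x, ?_, -b, rfl, by abel⟩
  exact (Set.mem_inv_smul_set_iff₀ ha.ne' _ _).2 hx

theorem isBounded_hitSet {S : Configuration n} (hS : S.Nonempty) {a : ℝ} (ha : 0 < a)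
    {X : Set Plane} (hX : Bornology.IsBounded X) : Bornology.IsBounded (hitSet ξ S a X) := by
  obtain ⟨j, hj⟩ := hS
  exact (isBounded_preimage_smul_add hX ha (pixel ξ j)).subset fun x hx => hx j hj

theorem measurableSet_hitSet (S : Configuration n) (a : ℝ)
    {X : Set Plane} (hX : MeasurableSet X) : MeasurableSet (hitSet ξ S a X) := by
  have : hitSet ξ S a X = ⋂ j ∈ S, (fun x => a • (pixel ξ j + x)) ⁻¹' X := by
    ext x; simp [hitSet]
  rw [this]
  exact Finset.measurableSet_biInter _ fun j _ =>
    (by fun_prop : Measurable fun x : Plane => a • (pixel ξ j + x)) hX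

namespace LocalEstimator

/-- The Möbius transform of the weights. -/
noncomputable def coeff (est : LocalEstimator ξ n) (a : ℝ) : Configuration n → ℝ :=
  moebiusTransform fun B => if B.Nonempty then est.weight a B else 0

/-- If `T k` is the set of black pixels seen at `k`, the estimator is the sum over `k` of the weight
of `T k`, which Möbius inversion splits into the coefficients of the subsets of `T k`. Giving the
empty configuration the value 0 makes its coefficient 0. -/
theorem estimate_eq_sum_coeff (est : LocalEstimator ξ n) {a : ℝ} (ha : 0 < a) (c : Plane)
    {X : Set Plane} (hX : Bornology.IsBounded X) :
    est.estimate a c X = ∑ S : Configuration n with S.Nonempty, est.coeff a S *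
      ({k : Fin 2 → ℤ | latticePoint ξ k + c ∈ hitSet ξ S a X}.ncard : ℝ) := by
  classical
  let T : (Fin 2 → ℤ) → Configuration n := fun k =>
    Finset.univ.filter fun j => a • (pixel ξ j + latticePoint ξ k + c) ∈ X
  have hfin : {k : Fin 2 → ℤ | (T k).Nonempty}.Finite := by
    have : {k : Fin 2 → ℤ | (T k).Nonempty}
        = ⋃ j : Fin 2 → Fin n, {k | latticePoint ξ k ∈ {x | a • ((pixel ξ j + c) + x) ∈ X}} := by
      ext k
      simp [T, Finset.filter_nonempty_iff, add_right_comm]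
    rw [this]
    exact Set.finite_iUnion fun j =>
      finite_latticePoint_mem (isBounded_preimage_smul_add hX ha _)
  set K := hfin.toFinset with hK
  -- Requiring `Q` to imply non-emptiness confines the counted indices to the finite set `K`, so
  -- that `ncard` is a true count.
  have key : ∀ (Q : Configuration n → Prop) [DecidablePred Q] (_ : ∀ B, Q B → B.Nonempty),
      (({k | Q (T k)}.ncard : ℕ) : ℝ) = ∑ k ∈ K, if Q (T k) then 1 else 0 := by
    intro Q _ hQ
    have : {k | Q (T k)} = ((K.filter fun k => Q (T k) : Finset _) : Set (Fin 2 → ℤ)) := by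
      ext k
      simpa [hK] using fun h => hQ _ h
    rw [this, Set.ncard_coe_finset, Finset.sum_boole]
  have h1 : ∀ B : Configuration n, B.Nonempty → (configurationCount ξ B a c X : ℝ)
      = ∑ k ∈ K, if T k = B then 1 else 0 := by
    intro B hB
    refine Eq.trans ?_ (key (fun U => U = B) (by rintro _ rfl; exact hB))
    rw [configurationCount]
    congr 3
    ext k
    constructor
    · rintro ⟨h1, h2⟩
      ext j
      by_cases hj : j ∈ B
      · simpa only [T, hj, Finset.mem_filter_univ, iff_true] using h1 j hj
      · simpa only [T, hj, Finset.mem_filter_univ, iff_false] using h2 j hj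
    · intro h
      have h : T k = B := h
      subst h
      simp [T]
  have h2 : ∀ S : Configuration n, S.Nonempty →
      ({k : Fin 2 → ℤ | latticePoint ξ k + c ∈ hitSet ξ S a X}.ncard : ℝ)
      = ∑ k ∈ K, if S ⊆ T k then 1 else 0 := by
    intro S hS
    refine Eq.trans ?_ (key (fun U => S ⊆ U) (fun U h => hS.mono h))
    congr 3
    ext k
    simp [hitSet, T, Finset.subset_iff, add_assoc]
  have h3 := Finset.sum_congr rfl fun B (hB : B ∈ Finset.univ.filter Finset.Nonempty) =>
    congrArg (est.weight a B * ·) (h1 B (Finset.mem_filter.1 hB).2)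
  have h4 := Finset.sum_congr rfl fun S (hS : S ∈ Finset.univ.filter Finset.Nonempty) =>
    congrArg (est.coeff a S * ·) (h2 S (Finset.mem_filter.1 hS).2)
  refine h3.trans (Eq.trans ?_ h4.symm)
  simp only [Finset.mul_sum]
  rw [Finset.sum_comm, Finset.sum_comm (t := K)]
  refine Finset.sum_congr rfl fun k _ => ?_
  have h5 := sum_powerset_moebiusTransform
    (fun B : Configuration n => if B.Nonempty then est.weight a B else 0) (T k)
  calc _ = if (T k).Nonempty then est.weight a (T k) else 0 := by
        rw [Finset.sum_filter]
        rw [Finset.sum_eq_single (T k)]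
        · simp
        · intro B _ hB
          simp [hB.symm]
        · simp
    _ = _ := by
        rw [← h5, Finset.sum_filter, ← Finset.filter_subset_univ, Finset.sum_filter]
        refine Finset.sum_congr rfl fun S _ => ?_
        rcases S.eq_empty_or_nonempty with rfl | hS
        · simp [moebiusTransform_empty]
        · simp [hS, coeff]

theorem coeff_eq_of_isHomogeneous {est : LocalEstimator ξ n} (h : est.IsHomogeneous 0) {a : ℝ}
    (ha : 0 < a) : est.coeff a = est.coeff 1 := by
  unfold coeff
  congr 1
  ext B
  split_ifs with hB
  · simpa using h a ha B hB
  · rfl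

theorem integrableOn_estimate (est : LocalEstimator ξ n) {a : ℝ} (ha : 0 < a)
    {X : Set Plane} (hX : Bornology.IsBounded X) (hm : MeasurableSet X) :
    IntegrableOn (fun c => est.estimate a c X) (parallelepiped ξ) := by
  simp only [est.estimate_eq_sum_coeff ha _ hX]
  refine integrable_finsetSum _ fun S hS => Integrable.const_mul ?_ _
  exact integrableOn_ncard (measurableSet_hitSet S a hm)
    (isBounded_hitSet (Finset.mem_filter.1 hS).2 ha hX).measure_lt_top.ne

theorem mean_eq_sum_coeff (est : LocalEstimator ξ n) {a : ℝ} (ha : 0 < a)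
    {X : Set Plane} (hX : Bornology.IsBounded X) (hm : MeasurableSet X) :
    est.mean a X = (volume.real (parallelepiped ξ))⁻¹ *
      ∑ S : Configuration n with S.Nonempty, est.coeff a S * volume.real (hitSet ξ S a X) := by
  rw [mean, setAverage_eq, smul_eq_mul]
  congr 1
  simp only [est.estimate_eq_sum_coeff ha _ hX]
  rw [integral_finsetSum]
  · refine Finset.sum_congr rfl fun S hS => ?_
    rw [integral_const_mul, integral_ncard (measurableSet_hitSet S a hm)
      (isBounded_hitSet (Finset.mem_filter.1 hS).2 ha hX).measure_lt_top.ne]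
  · refine fun S hS => Integrable.const_mul ?_ _
    exact integrableOn_ncard (measurableSet_hitSet S a hm)
      (isBounded_hitSet (Finset.mem_filter.1 hS).2 ha hX).measure_lt_top.ne

end LocalEstimator

theorem IsConvexPolygon.isCompact {P : Set Plane} (hP : IsConvexPolygon P) : IsCompact P := by
  obtain ⟨⟨s, rfl⟩, -⟩ := hP
  exact s.finite_toSet.isCompact_convexHull ℝ

theorem volume_real_parallelepiped_pos : 0 < volume.real (parallelepiped ξ) := by
  have h : volume (parallelepiped ξ) ≠ 0 := fun h0 => by
    have := ZSpan.measure_fundamentalDomain_ne_zero ξ (μ := (volume : Measure Plane))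
    rw [measure_congr (ZSpan.fundamentalDomain_ae_parallelepiped ξ volume)] at this
    exact this h0
  refine ENNReal.toReal_pos h ?_
  have := (ξ.parallelepiped.isCompact).measure_lt_top (μ := (volume : Measure Plane))
  rw [Module.Basis.coe_parallelepiped] at this
  exact this.ne

/-! ### Parallelograms in `perp` coordinates -/

/-- The determinant of the unit vector with polar angle `θ` and `x`. -/
noncomputable def perp (θ : ℝ) (x : Plane) : ℝ := Real.cos θ * x 1 - Real.sin θ * x 0

theorem perp_add (θ : ℝ) (x y : Plane) : perp θ (x + y) = perp θ x + perp θ y := by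
  simp [perp]; ring

theorem perp_sub (θ : ℝ) (x y : Plane) : perp θ (x - y) = perp θ x - perp θ y := by
  simp [perp]; ring

theorem perp_smul (θ t : ℝ) (x : Plane) : perp θ (t • x) = t * perp θ x := by
  simp [perp]; ring

theorem perp_unitVector (θ η : ℝ) : perp θ (unitVector η) = Real.sin (η - θ) := by
  simp [perp, unitVector, Real.sin_sub]; ring

theorem continuous_perp_left (x : Plane) : Continuous fun θ => perp θ x := by
  unfold perp; fun_prop

theorem continuous_perp (θ : ℝ) : Continuous (perp θ) := by
  unfold perp; fun_prop

/-- Three unit vectors in the plane satisfy a linear relation with sine coefficients, and `perp` is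
linear in its unit vector. -/
theorem sin_mul_perp (θ₁ θ₂ θ : ℝ) (x : Plane) :
    Real.sin (θ₂ - θ₁) * perp θ x
      = Real.sin (θ₂ - θ) * perp θ₁ x + Real.sin (θ - θ₁) * perp θ₂ x := by
  simp only [perp, Real.sin_sub]
  ring

theorem sin_smul_eq (φ ψ : ℝ) (x : Plane) :
    Real.sin ψ • x = (-perp (φ + ψ) x) • unitVector φ + perp φ x • unitVector (φ + ψ) := by
  have h := Real.sin_sq_add_cos_sq φ
  ext i
  fin_cases i <;> simp [perp, unitVector, Real.sin_add, Real.cos_add]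
  · linear_combination (-Real.sin ψ * x 0) * h
  · linear_combination (-Real.sin ψ * x 1) * h

theorem mem_parallelogram_iff {φ ψ s₁ s₂ : ℝ} (hψ : 0 < Real.sin ψ) (h₁ : 0 < s₁) (h₂ : 0 < s₂)
    (x : Plane) : x ∈ parallelogram φ ψ s₁ s₂ ↔
      perp φ x ∈ Icc 0 (s₂ * Real.sin ψ) ∧ perp (φ + ψ) x ∈ Icc (-(s₁ * Real.sin ψ)) 0 := by
  have hv : perp (φ + ψ) (unitVector φ) = - Real.sin ψ := by
    rw [perp_unitVector, ← Real.sin_neg]; congr 1; ring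
  have hw : perp φ (unitVector (φ + ψ)) = Real.sin ψ := by
    rw [perp_unitVector]; congr 1; ring
  have hv0 : perp φ (unitVector φ) = 0 := by simp [perp_unitVector]
  have hw0 : perp (φ + ψ) (unitVector (φ + ψ)) = 0 := by simp [perp_unitVector]
  constructor
  · intro hx
    obtain ⟨y, hy, z, hz, rfl⟩ := Set.mem_add.1 hx
    rw [segment_eq_image] at hy hz
    obtain ⟨t, ht, rfl⟩ := hy
    obtain ⟨r, hr, rfl⟩ := hz
    simp only [smul_zero, zero_add, perp_add, perp_smul, hv, hw, hv0, hw0, mul_zero, add_zero]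
    have h3 := mul_pos h₁ hψ
    have h4 := mul_pos h₂ hψ
    refine ⟨⟨?_, ?_⟩, ?_, ?_⟩ <;> nlinarith [ht.1, ht.2, hr.1, hr.2]
  · rintro ⟨⟨h3, h4⟩, h5, h6⟩
    have hx : x = (-perp (φ + ψ) x / Real.sin ψ) • unitVector φ
        + (perp φ x / Real.sin ψ) • unitVector (φ + ψ) := by
      rw [div_eq_inv_mul, div_eq_inv_mul, mul_smul, mul_smul, ← smul_add, ← sin_smul_eq,
        inv_smul_smul₀ hψ.ne']
    rw [hx]
    refine Set.add_mem_add ?_ ?_ <;> rw [segment_eq_image]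
    · refine ⟨-perp (φ + ψ) x / Real.sin ψ / s₁,
        ⟨div_nonneg (div_nonneg (by linarith) hψ.le) h₁.le, ?_⟩, ?_⟩
      · rw [div_div, div_le_one (by positivity)]; linarith
      · simp only [smul_zero, zero_add]
        rw [smul_smul, div_mul_cancel₀ _ h₁.ne']
    · refine ⟨perp φ x / Real.sin ψ / s₂, ⟨by positivity, ?_⟩, ?_⟩
      · rw [div_div, div_le_one (by positivity)]; linarith
      · simp only [smul_zero, zero_add]
        rw [smul_smul, div_mul_cancel₀ _ h₂.ne']

/-- The map `x ↦ (perp φ x, perp (φ + ψ) x)` has determinant `sin ψ` and carries the set onto a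
rectangle. -/
theorem volume_real_perp_mem_Icc {φ ψ A B A' B' : ℝ} (hψ : 0 < Real.sin ψ) (h : A ≤ B)
    (h' : A' ≤ B') :
    (volume : Measure Plane).real {x | perp φ x ∈ Icc A B ∧ perp (φ + ψ) x ∈ Icc A' B'}
      = (B - A) * (B' - A') / Real.sin ψ := by
  let M : Matrix (Fin 2) (Fin 2) ℝ :=
    !![-Real.sin φ, Real.cos φ; -Real.sin (φ + ψ), Real.cos (φ + ψ)]
  have hdet : LinearMap.det (Matrix.toLin' M) = Real.sin ψ := by
    rw [LinearMap.det_toLin', Matrix.det_fin_two_of]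
    have h1 : Real.sin ψ = Real.sin (φ + ψ - φ) := by congr 1; ring
    rw [h1, Real.sin_sub]; ring
  have hle : ![A, A'] ≤ ![B, B'] := by
    intro i; fin_cases i <;> simpa
  have hset : {x : Plane | perp φ x ∈ Icc A B ∧ perp (φ + ψ) x ∈ Icc A' B'}
      = WithLp.ofLp ⁻¹' (Matrix.toLin' M ⁻¹' Icc ![A, A'] ![B, B']) := by
    ext x
    have h0 : Matrix.toLin' M x.ofLp 0 = perp φ x := by
      simp [M, perp, Matrix.mulVec, dotProduct]; ring
    have h1 : Matrix.toLin' M x.ofLp 1 = perp (φ + ψ) x := by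
      simp [M, perp, Matrix.mulVec, dotProduct]; ring
    simp only [mem_ofPred_eq, mem_preimage, mem_Icc, Pi.le_def, Fin.forall_fin_two, h0, h1]
    simp only [Matrix.cons_val_zero, Matrix.cons_val_one]
    tauto
  have hmeas : MeasurableSet (Matrix.toLin' M ⁻¹' Icc ![A, A'] ![B, B']) :=
    (LinearMap.continuous_of_finiteDimensional _).measurable measurableSet_Icc
  rw [measureReal_def, hset, (PiLp.volume_preserving_ofLp (Fin 2)).measure_preimage
    hmeas.nullMeasurableSet, Measure.addHaar_preimage_linearMap _ (by rw [hdet]; exact hψ.ne'),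
    hdet, ENNReal.toReal_mul, Real.volume_Icc_pi_toReal hle, abs_of_pos (inv_pos.2 hψ),
    ENNReal.toReal_ofReal (inv_pos.2 hψ).le, Fin.prod_univ_two]
  simp only [Matrix.cons_val_zero, Matrix.cons_val_one]
  field_simp

theorem isConvexPolygon_parallelogram {φ ψ s₁ s₂ : ℝ} (hψ : 0 < Real.sin ψ) (h₁ : 0 < s₁)
    (h₂ : 0 < s₂) : IsConvexPolygon (parallelogram φ ψ s₁ s₂) := by
  classical
  constructor
  · refine ⟨{0, s₁ • unitVector φ} + {0, s₂ • unitVector (φ + ψ)}, ?_⟩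
    rw [Finset.coe_add, convexHull_add]
    simp only [Finset.coe_insert, Finset.coe_singleton, convexHull_pair]
    rfl
  · have hopen : IsOpen {x : Plane | perp φ x ∈ Ioo 0 (s₂ * Real.sin ψ) ∧
        perp (φ + ψ) x ∈ Ioo (-(s₁ * Real.sin ψ)) 0} :=
      (isOpen_Ioo.preimage (continuous_perp φ)).inter (isOpen_Ioo.preimage (continuous_perp _))
    refine ⟨(s₁ / 2) • unitVector φ + (s₂ / 2) • unitVector (φ + ψ),
      mem_interior.2 ⟨_, ?_, hopen, ?_⟩⟩
    · intro x hx
      exact (mem_parallelogram_iff hψ h₁ h₂ x).2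
        ⟨Ioo_subset_Icc_self hx.1, Ioo_subset_Icc_self hx.2⟩
    · have hv : perp (φ + ψ) (unitVector φ) = - Real.sin ψ := by
        rw [perp_unitVector, ← Real.sin_neg]; congr 1; ring
      have hw : perp φ (unitVector (φ + ψ)) = Real.sin ψ := by
        rw [perp_unitVector]; congr 1; ring
      have hv0 : perp φ (unitVector φ) = 0 := by simp [perp_unitVector]
      have hw0 : perp (φ + ψ) (unitVector (φ + ψ)) = 0 := by simp [perp_unitVector]
      have h3 := mul_pos h₁ hψ
      have h4 := mul_pos h₂ hψ
      simp only [mem_ofPred_eq, perp_add, perp_smul, hv, hw, hv0, hw0, mem_Ioo]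
      refine ⟨⟨?_, ?_⟩, ?_, ?_⟩ <;> linarith

/-- The intrinsic volume of degree zero of a bounded non-empty set is one. -/
theorem intrinsicVolumeZero_eq_one {X : Set Plane} (hb : Bornology.IsBounded X)
    (hne : X.Nonempty) : intrinsicVolumeZero X = 1 := by
  obtain ⟨x, hx⟩ := hne
  obtain ⟨R, hR0, hR⟩ : ∃ R : ℝ, 0 < R ∧ X ⊆ Metric.closedBall 0 R :=
    hb.subset_closedBall_lt 0 0
  have hball : ∀ (y : Plane) (r : ℝ), 0 ≤ r →
      (volume : Measure Plane).real (Metric.closedBall y r) = Real.pi * r ^ 2 := by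
    intro y r hr
    rw [measureReal_def, EuclideanSpace.volume_closedBall_fin_two]
    simp [hr, Real.pi_pos.le, mul_comm]
  -- The parallel set lies between a ball of radius `r` about a point of `X` and the ball of radius
  -- `R + r` about the origin.
  refine Tendsto.limUnder_eq (tendsto_of_tendsto_of_tendsto_of_le_of_le'
    (g := fun _ => 1) (h := fun r => (1 + R * r⁻¹) ^ 2) tendsto_const_nhds ?_ ?_ ?_)
  · have := ((tendsto_inv_atTop_zero (𝕜 := ℝ)).const_mul R).const_add 1 |>.pow 2
    simpa using this
  · filter_upwards [eventually_gt_atTop 0] with r hr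
    rw [le_div_iff₀ (by positivity), one_mul, ← hball x r hr.le]
    refine measureReal_mono ?_ ?_
    · intro y hy
      exact Set.mem_add.2 ⟨x, hx, y - x, by simpa [dist_eq_norm] using hy, by abel⟩
    · exact (hb.add Metric.isBounded_closedBall).measure_lt_top.ne
  · filter_upwards [eventually_gt_atTop 0] with r hr
    have h1 : (volume : Measure Plane).real (X + Metric.closedBall 0 r)
        ≤ Real.pi * (R + r) ^ 2 := by
      rw [← hball 0 (R + r) (by positivity)]
      refine measureReal_mono ?_ Metric.isBounded_closedBall.measure_lt_top.ne
      rintro _ ⟨y, hy, z, hz, rfl⟩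
      have h2 := hR hy
      simp only [Metric.mem_closedBall, dist_zero_right] at h2 hz ⊢
      exact (norm_add_le _ _).trans (add_le_add h2 hz)
    rw [div_le_iff₀ (by positivity)]
    refine h1.trans (le_of_eq ?_)
    field_simp
    ring

/-! ### The order of pixels in directions avoiding the lattice directions -/

theorem pixel_sub_pixel (j j' : Fin 2 → Fin n) :
    pixel ξ j - pixel ξ j' = latticePoint ξ fun i => ((j i : ℕ) : ℤ) - ((j' i : ℕ) : ℤ) := by
  simp [pixel, latticePoint, sub_smul]

theorem latticePoint_neg (k : Fin 2 → ℤ) : latticePoint ξ (-k) = -latticePoint ξ k := by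
  simp [latticePoint]

theorem latticePoint_ne_zero {k : Fin 2 → ℤ} (hk : k ≠ 0) : latticePoint ξ k ≠ 0 := fun h =>
  hk (latticePoint_injective ξ (h.trans (by simp [latticePoint])))

theorem norm_unitVector (θ : ℝ) : ‖unitVector θ‖ = 1 := by
  simp [EuclideanSpace.norm_eq, unitVector]

theorem eq_smul_unitVector {θ : ℝ} {x : Plane} (h : perp θ x = 0) :
    x = (Real.cos θ * x 0 + Real.sin θ * x 1) • unitVector θ := by
  have h1 := Real.sin_sq_add_cos_sq θ
  unfold perp at h
  ext i
  fin_cases i <;> simp [unitVector]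
  · linear_combination (-x 0) * h1 - Real.sin θ * h
  · linear_combination (-x 1) * h1 + Real.cos θ * h

theorem unitVector_eq_of_perp_eq_zero {θ : ℝ} {x : Plane} (hx : x ≠ 0) (h : perp θ x = 0) :
    unitVector θ = ‖x‖⁻¹ • x ∨ unitVector θ = ‖-x‖⁻¹ • (-x) := by
  obtain ⟨t, ht⟩ : ∃ t : ℝ, x = t • unitVector θ := ⟨_, eq_smul_unitVector h⟩
  have ht0 : t ≠ 0 := by
    rintro rfl
    simp [ht] at hx
  rw [norm_neg, ht, norm_smul, norm_unitVector, mul_one, Real.norm_eq_abs]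
  rcases ht0.lt_or_gt with h0 | h0
  · right
    rw [abs_of_neg h0, ← neg_smul, inv_smul_smul₀ (neg_ne_zero.2 ht0)]
  · left
    rw [abs_of_pos h0, inv_smul_smul₀ ht0]

/-- Otherwise the difference of the two pixels, or its negative, would point in direction `θ`; its
coordinates lie strictly between `-n` and `n`. -/
theorem perp_pixel_sub_ne_zero {θ : ℝ} (hθ : unitVector θ ∉ latticeDirections ξ n)
    {j j' : Fin 2 → Fin n} (hj : j ≠ j') : perp θ (pixel ξ j - pixel ξ j') ≠ 0 := by
  intro h
  set k : Fin 2 → ℤ := fun i => ((j i : ℕ) : ℤ) - ((j' i : ℕ) : ℤ) with hk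
  have hk0 : k ≠ 0 := by
    intro h0
    apply hj
    ext i
    have := congrFun h0 i
    simp only [hk, Pi.zero_apply] at this
    omega
  rw [pixel_sub_pixel] at h
  apply hθ
  rcases unitVector_eq_of_perp_eq_zero (latticePoint_ne_zero hk0) h with h1 | h1
  · refine ⟨k, fun i => ?_, hk0, h1⟩
    have := (j i).2
    have := (j' i).2
    simp only [hk]
    omega
  · refine ⟨-k, fun i => ?_, neg_ne_zero.2 hk0, by rwa [latticePoint_neg]⟩
    have := (j i).2
    have := (j' i).2
    simp only [hk, Pi.neg_apply]
    omega

/-- A reversal of the order between `θ₀` and `θ` would, by the intermediate value theorem, produce a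
direction in the interval parallel to a pixel difference. -/
theorem perp_pixel_le_of_perp_pixel_le {p q : ℝ}
    (hdir : ∀ θ ∈ Ioo p q, unitVector θ ∉ latticeDirections ξ n) {θ₀ θ : ℝ} (hθ₀ : θ₀ ∈ Ioo p q)
    (hθ : θ ∈ Ioo p q) {j j' : Fin 2 → Fin n} (h : perp θ₀ (pixel ξ j) ≤ perp θ₀ (pixel ξ j')) :
    perp θ (pixel ξ j) ≤ perp θ (pixel ξ j') := by
  by_contra! hlt
  have hne : j' ≠ j := by
    rintro rfl
    exact lt_irrefl _ hlt
  obtain ⟨η, hη, h0⟩ := isPreconnected_Ioo.intermediate_value hθ hθ₀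
    (continuous_perp_left (pixel ξ j' - pixel ξ j)).continuousOn
    (show (0 : ℝ) ∈ Icc _ _ by simp only [perp_sub, mem_Icc]; constructor <;> linarith)
  exact perp_pixel_sub_ne_zero (hdir η hη) hne h0

/-- The pixels `M` and `m` of `S` are the extreme ones with respect to all `perp θ`, `p < θ < q`. -/
def IsExtremal (ξ : Module.Basis (Fin 2) ℝ Plane) (p q : ℝ) (S : Configuration n)
    (M m : Fin 2 → Fin n) : Prop :=
  M ∈ S ∧ m ∈ S ∧ ∀ θ ∈ Ioo p q, ∀ j ∈ S,
    perp θ (pixel ξ m) ≤ perp θ (pixel ξ j) ∧ perp θ (pixel ξ j) ≤ perp θ (pixel ξ M)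

theorem exists_isExtremal {p q : ℝ}
    (hdir : ∀ θ ∈ Ioo p q, unitVector θ ∉ latticeDirections ξ n) {S : Configuration n}
    (hS : S.Nonempty) : ∃ M m, IsExtremal ξ p q S M m := by
  rcases (Ioo p q).eq_empty_or_nonempty with h | ⟨θ₀, hθ₀⟩
  · obtain ⟨j, hj⟩ := hS
    exact ⟨j, j, hj, hj, by simp [h]⟩
  · obtain ⟨M, hM, hM'⟩ := S.exists_max_image (fun j => perp θ₀ (pixel ξ j)) hS
    obtain ⟨m, hm, hm'⟩ := S.exists_min_image (fun j => perp θ₀ (pixel ξ j)) hS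
    exact ⟨M, m, hM, hm, fun θ hθ j hj =>
      ⟨perp_pixel_le_of_perp_pixel_le hdir hθ₀ hθ (hm' j hj),
        perp_pixel_le_of_perp_pixel_le hdir hθ₀ hθ (hM' j hj)⟩⟩

/-- One vector `D S` serves every `θ` in the interval, so the width `perp θ (D S)` of `S` is linear
in the unit vector of angle `θ`. -/
theorem exists_extent {p q : ℝ}
    (hdir : ∀ θ ∈ Ioo p q, unitVector θ ∉ latticeDirections ξ n) :
    ∃ D : Configuration n → Plane, ∀ S : Configuration n, S.Nonempty →
      ∃ M m, IsExtremal ξ p q S M m ∧ D S = pixel ξ M - pixel ξ m := by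
  have : ∀ S : Configuration n, ∃ d : Plane, S.Nonempty →
      ∃ M m, IsExtremal ξ p q S M m ∧ d = pixel ξ M - pixel ξ m := by
    intro S
    by_cases hS : S.Nonempty
    · obtain ⟨M, m, h⟩ := exists_isExtremal hdir hS
      exact ⟨_, fun _ => ⟨M, m, h, rfl⟩⟩
    · exact ⟨0, fun h => absurd h hS⟩
  choose D hD using this
  exact ⟨D, hD⟩

/-- Each of the four edges constrains the translate of `S` only through the pixel extremal in its
normal direction. -/
theorem hitSet_parallelogram {p q φ ψ s₁ s₂ a : ℝ} (hφ : φ ∈ Ioo p q) (hφψ : φ + ψ ∈ Ioo p q)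
    (hψ : 0 < Real.sin ψ) (h₁ : 0 < s₁) (h₂ : 0 < s₂) (ha : 0 < a) {S : Configuration n}
    {M m : Fin 2 → Fin n} (h : IsExtremal ξ p q S M m) :
    hitSet ξ S a (parallelogram φ ψ s₁ s₂) = {x |
      perp φ x ∈ Icc (-perp φ (pixel ξ m)) (s₂ * Real.sin ψ / a - perp φ (pixel ξ M)) ∧
      perp (φ + ψ) x ∈ Icc (-(s₁ * Real.sin ψ / a) - perp (φ + ψ) (pixel ξ m))
        (-perp (φ + ψ) (pixel ξ M))} := by
  obtain ⟨hM, hm, hS⟩ := h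
  have key : ∀ t s : ℝ, t ≤ s / a ↔ a * t ≤ s := fun t s => by
    rw [le_div_iff₀ ha, mul_comm]
  have key' : ∀ t s : ℝ, -(s / a) ≤ t ↔ -s ≤ a * t := fun t s => by
    rw [← neg_div, div_le_iff₀ ha, mul_comm]
  have hmem : ∀ (x : Plane) (j : Fin 2 → Fin n), a • (pixel ξ j + x) ∈ parallelogram φ ψ s₁ s₂ ↔
      (0 ≤ perp φ (pixel ξ j) + perp φ x ∧
        perp φ (pixel ξ j) + perp φ x ≤ s₂ * Real.sin ψ / a) ∧
      -(s₁ * Real.sin ψ / a) ≤ perp (φ + ψ) (pixel ξ j) + perp (φ + ψ) x ∧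
        perp (φ + ψ) (pixel ξ j) + perp (φ + ψ) x ≤ 0 := by
    intro x j
    rw [mem_parallelogram_iff hψ h₁ h₂, perp_smul, perp_smul, perp_add, perp_add, key, key',
      mem_Icc, mem_Icc, mul_nonneg_iff_of_pos_left ha,
      show ∀ t : ℝ, a * t ≤ 0 ↔ t ≤ 0 from fun t => by
        simpa using mul_le_mul_iff_right₀ (b := t) (c := 0) ha]
  ext x
  simp only [hitSet, mem_ofPred_eq, hmem, mem_Icc]
  constructor
  · intro hx
    have h3 := hx m hm
    have h4 := hx M hM
    refine ⟨⟨?_, ?_⟩, ?_, ?_⟩ <;> linarith [h3.1.1, h3.2.1, h4.1.2, h4.2.2]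
  · rintro ⟨⟨h3, h4⟩, h5, h6⟩ j hj
    have h7 := hS φ hφ j hj
    have h8 := hS _ hφψ j hj
    refine ⟨⟨?_, ?_⟩, ?_, ?_⟩ <;> linarith [h7.1, h7.2, h8.1, h8.2]

theorem volume_real_hitSet_parallelogram {p q φ ψ s₁ s₂ : ℝ} (hφ : φ ∈ Ioo p q)
    (hφψ : φ + ψ ∈ Ioo p q) (hψ : 0 < Real.sin ψ) (h₁ : 0 < s₁) (h₂ : 0 < s₂)
    {S : Configuration n} {M m : Fin 2 → Fin n} (h : IsExtremal ξ p q S M m) :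
    ∀ᶠ a in 𝓝[>] (0 : ℝ), volume.real (hitSet ξ S a (parallelogram φ ψ s₁ s₂))
      = (s₂ * Real.sin ψ / a - perp φ (pixel ξ M - pixel ξ m)) *
        (s₁ * Real.sin ψ / a - perp (φ + ψ) (pixel ξ M - pixel ξ m)) / Real.sin ψ := by
  have hlim : ∀ s : ℝ, 0 < s → ∀ C : ℝ, ∀ᶠ a in 𝓝[>] (0 : ℝ), C ≤ s * Real.sin ψ / a :=
    fun s hs C => (tendsto_inv_nhdsGT_zero.const_mul_atTop (mul_pos hs hψ)).eventually_ge_atTop C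
  filter_upwards [hlim s₁ h₁ (perp (φ + ψ) (pixel ξ M) - perp (φ + ψ) (pixel ξ m)),
    hlim s₂ h₂ (perp φ (pixel ξ M) - perp φ (pixel ξ m)), self_mem_nhdsWithin] with a ha₁ ha₂ ha
  rw [hitSet_parallelogram hφ hφψ hψ h₁ h₂ ha h,
    volume_real_perp_mem_Icc hψ (by linarith) (by linarith), perp_sub, perp_sub]
  ring

/-! ### The mean on a parallelogram -/

namespace LocalEstimator

/-- The bilinear form in the unit vectors with polar angles `θ` and `η` that governs the constant
term of the mean of the estimator on small-scale digitizations of parallelograms. -/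
noncomputable def cornerForm (est : LocalEstimator ξ n) (D : Configuration n → Plane)
    (a θ η : ℝ) : ℝ :=
  ∑ S : Configuration n with S.Nonempty, est.coeff a S * (perp θ (D S) * perp η (D S))

theorem cornerForm_comm (est : LocalEstimator ξ n) (D : Configuration n → Plane) (a θ η : ℝ) :
    est.cornerForm D a θ η = est.cornerForm D a η θ := by
  simp only [cornerForm, mul_comm (perp θ _)]

/-- This expresses linearity in the first unit vector using angles alone, a form that passes to
pointwise limits. -/
theorem sin_mul_cornerForm (est : LocalEstimator ξ n) (D : Configuration n → Plane)
    (a θ₁ θ₂ θ η : ℝ) : Real.sin (θ₂ - θ₁) * est.cornerForm D a θ η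
      = Real.sin (θ₂ - θ) * est.cornerForm D a θ₁ η
        + Real.sin (θ - θ₁) * est.cornerForm D a θ₂ η := by
  simp only [cornerForm, Finset.mul_sum, ← Finset.sum_add_distrib]
  refine Finset.sum_congr rfl fun S _ => ?_
  linear_combination (est.coeff a S * perp η (D S)) * sin_mul_perp θ₁ θ₂ θ (D S)

/-- Expanding the product of the two side factors sorts the mean by powers of `s₁` and `s₂`. Writing
the powers of `a` as denominators leaves numerators that do not depend on `a` for homogeneous
weights. -/
theorem mean_parallelogram (est : LocalEstimator ξ n) {p q : ℝ} {D : Configuration n → Plane}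
    (hD : ∀ S : Configuration n, S.Nonempty →
      ∃ M m, IsExtremal ξ p q S M m ∧ D S = pixel ξ M - pixel ξ m)
    {φ ψ s₁ s₂ : ℝ} (hφ : φ ∈ Ioo p q) (hφψ : φ + ψ ∈ Ioo p q) (hψ : 0 < Real.sin ψ)
    (h₁ : 0 < s₁) (h₂ : 0 < s₂) :
    ∀ᶠ a in 𝓝[>] (0 : ℝ), est.mean a (parallelogram φ ψ s₁ s₂) =
      (volume.real (parallelepiped ξ))⁻¹ * ((∑ S : Configuration n with S.Nonempty, est.coeff a S)
        * Real.sin ψ) / a ^ 2 * (s₁ * s₂)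
      + -((volume.real (parallelepiped ξ))⁻¹ *
        ∑ S : Configuration n with S.Nonempty, est.coeff a S * perp φ (D S)) / a * s₁
      + -((volume.real (parallelepiped ξ))⁻¹ *
        ∑ S : Configuration n with S.Nonempty, est.coeff a S * perp (φ + ψ) (D S)) / a * s₂
      + (volume.real (parallelepiped ξ))⁻¹ * est.cornerForm D a φ (φ + ψ) / Real.sin ψ := by
  have hvol : ∀ S ∈ Finset.univ.filter (Finset.Nonempty (α := Fin 2 → Fin n)),
      ∀ᶠ a in 𝓝[>] (0 : ℝ), volume.real (hitSet ξ S a (parallelogram φ ψ s₁ s₂))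
      = (s₂ * Real.sin ψ / a - perp φ (D S)) *
        (s₁ * Real.sin ψ / a - perp (φ + ψ) (D S)) / Real.sin ψ := by
    intro S hS
    obtain ⟨M, m, h, hDS⟩ := hD S (Finset.mem_filter.1 hS).2
    rw [hDS]
    exact volume_real_hitSet_parallelogram hφ hφψ hψ h₁ h₂ h
  have hP := (isConvexPolygon_parallelogram (φ := φ) hψ h₁ h₂).isCompact
  filter_upwards [(Finset.eventually_all _).2 hvol, self_mem_nhdsWithin] with a ha ha0
  have ha0' : a ≠ 0 := (mem_Ioi.1 ha0).ne'
  rw [est.mean_eq_sum_coeff ha0 hP.isBounded hP.measurableSet,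
    Finset.sum_congr rfl fun S hS => by rw [ha S hS]]
  simp only [cornerForm, Finset.mul_sum, Finset.sum_mul, Finset.sum_div, ← Finset.sum_neg_distrib,
    ← Finset.sum_add_distrib]
  refine Finset.sum_congr rfl fun S _ => ?_
  field_simp
  ring

end LocalEstimator

/-! ### Limits of bidegree (1, 1) polynomials and of bilinear forms -/

/-- If a polynomial of bidegree `(1, 1)` converges pointwise on the positive quadrant, then its
coefficients converge. -/
theorem tendsto_coeff_of_tendsto_bilinear {α : Type*} {F : Filter α} [F.NeBot]
    {A B C G : α → ℝ} {L : ℝ → ℝ → ℝ}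
    (h : ∀ s₁ s₂ : ℝ, 0 < s₁ → 0 < s₂ →
      Tendsto (fun a => A a * (s₁ * s₂) + B a * s₁ + C a * s₂ + G a) F (𝓝 (L s₁ s₂))) :
    ∃ α β γ : ℝ, Tendsto A F (𝓝 α) ∧ Tendsto B F (𝓝 β) ∧ Tendsto C F (𝓝 γ) ∧
      Tendsto G F (𝓝 (4 * L 1 1 - 2 * L 1 2 - 2 * L 2 1 + L 2 2)) ∧
      ∀ s₁ s₂ : ℝ, 0 < s₁ → 0 < s₂ → L s₁ s₂ = α * (s₁ * s₂) + β * s₁ + γ * s₂ +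
        (4 * L 1 1 - 2 * L 1 2 - 2 * L 2 1 + L 2 2) := by
  -- Four values on the grid `{1, 2} × {1, 2}` determine the four coefficients by differencing and
  -- extrapolation to `(0, 0)`.
  have h11 := h 1 1 one_pos one_pos
  have h12 := h 1 2 one_pos two_pos
  have h21 := h 2 1 two_pos one_pos
  have h22 := h 2 2 two_pos two_pos
  have hA : Tendsto A F (𝓝 (L 2 2 - L 1 2 - L 2 1 + L 1 1)) :=
    (((h22.sub h12).sub h21).add h11).congr fun a => by ring
  have hB : Tendsto B F (𝓝 (L 2 1 - L 1 1 - (L 2 2 - L 1 2 - L 2 1 + L 1 1))) :=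
    ((h21.sub h11).sub hA).congr fun a => by ring
  have hC : Tendsto C F (𝓝 (L 1 2 - L 1 1 - (L 2 2 - L 1 2 - L 2 1 + L 1 1))) :=
    ((h12.sub h11).sub hA).congr fun a => by ring
  have hG : Tendsto G F (𝓝 (4 * L 1 1 - 2 * L 1 2 - 2 * L 2 1 + L 2 2)) :=
    ((((h11.const_mul 4).sub (h12.const_mul 2)).sub (h21.const_mul 2)).add h22).congr
      fun a => by ring
  refine ⟨_, _, _, hA, hB, hC, hG, fun s₁ s₂ h₁ h₂ => ?_⟩
  exact tendsto_nhds_unique (h s₁ s₂ h₁ h₂)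
    ((((hA.mul_const _).add (hB.mul_const _)).add (hC.mul_const _)).add hG)

/-- A pointwise limit of symmetric bilinear forms, evaluated at pairs of distinct unit vectors with
polar angles in an interval, vanishes or has a non-zero limit on the diagonal. -/
theorem eq_zero_or_tendsto_diagonal {α : Type*} {F : Filter α} [F.NeBot] {Q : α → ℝ → ℝ → ℝ}
    (hsymm : ∀ a θ η, Q a θ η = Q a η θ)
    (hlin : ∀ a θ₁ θ₂ θ η, Real.sin (θ₂ - θ₁) * Q a θ η
      = Real.sin (θ₂ - θ) * Q a θ₁ η + Real.sin (θ - θ₁) * Q a θ₂ η)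
    {p q : ℝ} {R : ℝ → ℝ → ℝ}
    (hR : ∀ φ ψ : ℝ, φ ∈ Ioo p q → φ + ψ ∈ Ioo p q → ψ ∈ Ioo 0 Real.pi →
      Tendsto (fun a => Q a φ (φ + ψ)) F (𝓝 (R φ ψ))) :
    (∀ φ ψ : ℝ, φ ∈ Ioo p q → φ + ψ ∈ Ioo p q → ψ ∈ Ioo 0 Real.pi → R φ ψ = 0) ∨
      ∃ φ ∈ Ioo p q, ∃ c : ℝ, c ≠ 0 ∧ Tendsto (R φ) (𝓝[>] 0) (𝓝 c) := by
  rcases le_or_gt q p with hpq | hpq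
  · left
    intro φ ψ hφ
    rw [Ioo_eq_empty_of_le hpq] at hφ
    exact absurd hφ (notMem_empty _)
  -- The angles `t - d`, `t`, `t + d` must lie in the interval, with `2 * d < π` so that the outer
  -- two give a basis.
  obtain ⟨d, hd0, hd1, hd2⟩ : ∃ d : ℝ, 0 < d ∧ d ≤ 1 ∧ d ≤ (q - p) / 4 :=
    ⟨min 1 ((q - p) / 4), lt_min one_pos (by linarith), min_le_left _ _, min_le_right _ _⟩
  have hpi := Real.pi_gt_three
  obtain ⟨t, ht⟩ : ∃ t, t = (p + q) / 2 := ⟨_, rfl⟩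
  have hs1 : 0 < Real.sin d := Real.sin_pos_of_pos_of_lt_pi hd0 (by linarith)
  have hs2 : 0 < Real.sin (2 * d) := Real.sin_pos_of_pos_of_lt_pi (by linarith) (by linarith)
  set s := Real.sin (2 * d) with hs
  have mem1 : t - d ∈ Ioo p q := ⟨by linarith, by linarith⟩
  have mem2 : t ∈ Ioo p q := ⟨by linarith, by linarith⟩
  have mem3 : t + d ∈ Ioo p q := ⟨by linarith, by linarith⟩
  have e31 : t + d - (t - d) = 2 * d := by ring
  have e32 : t + d - t = d := by ring
  have e21 : t - (t - d) = d := by ring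
  obtain ⟨q13, h13⟩ : ∃ l, Tendsto (fun a => Q a (t - d) (t + d)) F (𝓝 l) := by
    have := hR (t - d) (2 * d) mem1 (by convert mem3 using 1; ring)
      ⟨by linarith, by linarith⟩
    rw [show t - d + 2 * d = t + d by ring] at this
    exact ⟨_, this⟩
  obtain ⟨q12, h12⟩ : ∃ l, Tendsto (fun a => Q a (t - d) t) F (𝓝 l) := by
    have := hR (t - d) d mem1 (by convert mem2 using 1; ring) ⟨hd0, by linarith⟩
    rw [sub_add_cancel] at this
    exact ⟨_, this⟩
  obtain ⟨q23, h23⟩ : ∃ l, Tendsto (fun a => Q a t (t + d)) F (𝓝 l) :=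
    ⟨_, hR t d mem2 mem3 ⟨hd0, by linarith⟩⟩
  -- The hypothesis covers only distinct angles; the diagonal values follow from off-diagonal ones
  -- by the linear relation between the three unit vectors.
  obtain ⟨q11, h11⟩ : ∃ l, Tendsto (fun a => Q a (t - d) (t - d)) F (𝓝 l) := by
    refine ⟨_, ((h12.const_mul (s / Real.sin d)).sub h13).congr fun a => ?_⟩
    have := hlin a (t - d) (t + d) t (t - d)
    rw [e31, e32, e21, hsymm a t, hsymm a (t + d)] at this
    field_simp
    linear_combination this
  obtain ⟨q33, h33⟩ : ∃ l, Tendsto (fun a => Q a (t + d) (t + d)) F (𝓝 l) := by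
    refine ⟨_, ((h23.const_mul (s / Real.sin d)).sub h13).congr fun a => ?_⟩
    have := hlin a (t - d) (t + d) t (t + d)
    rw [e31, e32, e21] at this
    field_simp
    linear_combination this
  -- `H x y z` is the symmetric bilinear form with values `x`, `y`, `z` on the basis of angles `t -
  -- d` and `t + d`.
  let H : ℝ → ℝ → ℝ → ℝ → ℝ → ℝ := fun x y z θ η =>
    (Real.sin (t + d - θ) * (Real.sin (t + d - η) * x + Real.sin (η - (t - d)) * y)
      + Real.sin (θ - (t - d)) * (Real.sin (t + d - η) * y + Real.sin (η - (t - d)) * z)) / s ^ 2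
  have hQ : ∀ θ η a,
      H (Q a (t - d) (t - d)) (Q a (t - d) (t + d)) (Q a (t + d) (t + d)) θ η = Q a θ η := by
    intro θ η a
    have h1 := hlin a (t - d) (t + d) θ η
    have h2 := hlin a (t - d) (t + d) η (t - d)
    have h3 := hlin a (t - d) (t + d) η (t + d)
    rw [hsymm a η, hsymm a (t + d) (t - d)] at h2
    rw [hsymm a η] at h3
    rw [e31] at h1 h2 h3
    simp only [H]
    rw [div_eq_iff (by positivity)]
    linear_combination (-s) * h1 - Real.sin (t + d - θ) * h2 - Real.sin (θ - (t - d)) * h3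
  have hlim : ∀ θ η, Tendsto (fun a => Q a θ η) F (𝓝 (H q11 q13 q33 θ η)) := fun θ η =>
    (((((h11.const_mul _).add (h13.const_mul _)).const_mul _).add
      (((h13.const_mul _).add (h33.const_mul _)).const_mul _)).div_const _).congr (hQ θ η)
  have hRH : ∀ φ ψ : ℝ, φ ∈ Ioo p q → φ + ψ ∈ Ioo p q → ψ ∈ Ioo 0 Real.pi →
      R φ ψ = H q11 q13 q33 φ (φ + ψ) := fun φ ψ h1 h2 h3 =>
    tendsto_nhds_unique (hR φ ψ h1 h2 h3) (hlim _ _)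
  by_cases hdiag : ∃ φ ∈ Ioo p q, H q11 q13 q33 φ φ ≠ 0
  · right
    obtain ⟨φ, hφ, hne⟩ := hdiag
    refine ⟨φ, hφ, _, hne, ?_⟩
    have hcont : Continuous fun ψ => H q11 q13 q33 φ (φ + ψ) := by
      simp only [H]
      fun_prop
    have h1 : Tendsto (fun ψ => H q11 q13 q33 φ (φ + ψ)) (𝓝[>] 0) (𝓝 (H q11 q13 q33 φ φ)) := by
      have := (hcont.tendsto 0).mono_left (nhdsWithin_le_nhds (s := Ioi 0))
      rwa [add_zero] at this
    refine h1.congr' ?_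
    have hpos : 0 < min (q - φ) Real.pi := lt_min (by linarith [hφ.2]) Real.pi_pos
    filter_upwards [Ioo_mem_nhdsGT hpos] with ψ hψ
    have h2 := hψ.2.trans_le (min_le_left _ _)
    exact (hRH φ ψ hφ ⟨by linarith [hφ.1, hψ.1], by linarith⟩
      ⟨hψ.1, hψ.2.trans_le (min_le_right _ _)⟩).symm
  · left
    push Not at hdiag
    -- Polarization: vanishing on the diagonal at `t - d` and `t + d` kills `q11` and `q33`, and
    -- then vanishing at `t` kills `q13`.
    have z1 := hdiag _ mem1
    have z2 := hdiag _ mem2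
    have z3 := hdiag _ mem3
    simp only [H, e31, sub_self, Real.sin_zero, zero_mul, add_zero, zero_add,
      div_eq_zero_iff, mul_eq_zero, hs2.ne', ← hs, pow_eq_zero_iff, false_or, or_false,
      ne_eq, OfNat.ofNat_ne_zero, not_false_eq_true] at z1 z3
    subst z1 z3
    simp only [H, e32, e21, mul_zero, add_zero, zero_add, div_eq_zero_iff, pow_eq_zero_iff,
      ne_eq, OfNat.ofNat_ne_zero, not_false_eq_true, hs2.ne', or_false] at z2
    have z13 : q13 = 0 := by
      have : Real.sin d * (Real.sin d * q13) = 0 := by linarith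
      simpa [hs1.ne'] using this
    subst z13
    intro φ ψ h1 h2 h3
    rw [hRH φ ψ h1 h2 h3]
    simp [H]

/-! ### The limit `L₀` and its dichotomy -/

namespace LocalEstimator

/-- The filter `F` is kept general because the bias bound needs limits along an ultrafilter, where
no convergence as `a → 0⁺` is assumed. -/
theorem exists_limit_parallelogram (est : LocalEstimator ξ n) {F : Filter ℝ} [F.NeBot]
    (hF : F ≤ 𝓝[>] 0) {p q : ℝ} (hdir : ∀ θ ∈ Ioo p q, unitVector θ ∉ latticeDirections ξ n)
    (L : ℝ → ℝ → ℝ → ℝ → ℝ)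
    (hL : ∀ φ ψ s₁ s₂ : ℝ, φ ∈ Ioo p q → φ + ψ ∈ Ioo p q → ψ ∈ Ioo 0 Real.pi →
      0 < s₁ → 0 < s₂ →
      Tendsto (fun a : ℝ => est.mean a (parallelogram φ ψ s₁ s₂)) F (𝓝 (L φ ψ s₁ s₂))) :
    ∃ L₀ : ℝ → ℝ → ℝ,
      (∀ φ ψ s₁ s₂ : ℝ, φ ∈ Ioo p q → φ + ψ ∈ Ioo p q → ψ ∈ Ioo 0 Real.pi → 0 < s₁ → 0 < s₂ →
        Tendsto (fun t : ℝ => L φ ψ (t * s₁) (t * s₂)) (𝓝[>] 0) (𝓝 (L₀ φ ψ))) ∧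
      (est.IsHomogeneous 0 →
        ∀ φ ψ s₁ s₂ : ℝ, φ ∈ Ioo p q → φ + ψ ∈ Ioo p q → ψ ∈ Ioo 0 Real.pi →
          0 < s₁ → 0 < s₂ → L φ ψ s₁ s₂ = L₀ φ ψ) ∧
      ((∀ φ ψ : ℝ, φ ∈ Ioo p q → φ + ψ ∈ Ioo p q → ψ ∈ Ioo 0 Real.pi → L₀ φ ψ = 0) ∨
        ∃ φ ∈ Ioo p q, Tendsto (L₀ φ) (𝓝[>] 0) atTop ∨ Tendsto (L₀ φ) (𝓝[>] 0) atBot) := by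
  obtain ⟨D, hD⟩ := exists_extent hdir
  have hV : 0 < volume.real (parallelepiped ξ) := volume_real_parallelepiped_pos
  let L₀ : ℝ → ℝ → ℝ := fun φ ψ => 4 * L φ ψ 1 1 - 2 * L φ ψ 1 2 - 2 * L φ ψ 2 1 + L φ ψ 2 2
  have key : ∀ φ ψ : ℝ, φ ∈ Ioo p q → φ + ψ ∈ Ioo p q → ψ ∈ Ioo 0 Real.pi → _ :=
    fun φ ψ hφ hφψ hψ => tendsto_coeff_of_tendsto_bilinear fun s₁ s₂ h₁ h₂ =>
      (hL φ ψ s₁ s₂ hφ hφψ hψ h₁ h₂).congr' (hF (est.mean_parallelogram hD hφ hφψ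
        (Real.sin_pos_of_mem_Ioo hψ) h₁ h₂))
  refine ⟨L₀, ?_, ?_, ?_⟩
  · intro φ ψ s₁ s₂ hφ hφψ hψ h₁ h₂
    obtain ⟨α, β, γ, -, -, -, -, h⟩ := key φ ψ hφ hφψ hψ
    have hcont : Continuous fun t : ℝ => α * ((t * s₁) * (t * s₂)) + β * (t * s₁) + γ * (t * s₂)
        + L₀ φ ψ := by fun_prop
    have h1 := (hcont.tendsto 0).mono_left (nhdsWithin_le_nhds (s := Ioi 0))
    simp only [zero_mul, mul_zero, zero_add] at h1
    refine h1.congr' ?_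
    filter_upwards [self_mem_nhdsWithin] with t ht
    exact (h _ _ (mul_pos ht h₁) (mul_pos ht h₂)).symm
  · intro hom φ ψ s₁ s₂ hφ hφψ hψ h₁ h₂
    obtain ⟨α, β, γ, hα, hβ, hγ, -, h⟩ := key φ ψ hφ hφψ hψ
    -- A constant divided by `a ^ k` with `k ≠ 0` can converge as `a → 0⁺` only if the constant is
    -- 0.
    have hzero : ∀ (f : ℝ → ℝ) {l : ℝ} (k : ℕ), k ≠ 0 →
        Tendsto (fun a => f a / a ^ k) F (𝓝 l) → (∀ a, 0 < a → f a = f 1) → l = 0 := by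
      intro f l k hk hf hconst
      have ha : Tendsto (fun a : ℝ => a ^ k) F (𝓝 0) := by
        have := ((continuous_pow (M := ℝ) k).tendsto 0).mono_left (hF.trans nhdsWithin_le_nhds)
        rwa [zero_pow hk] at this
      have h1 : f 1 = 0 := by
        have h2 := hf.mul ha
        rw [mul_zero] at h2
        refine tendsto_nhds_unique (tendsto_const_nhds.congr' ?_) h2
        filter_upwards [hF self_mem_nhdsWithin] with a ha0
        rw [div_mul_cancel₀ _ (pow_ne_zero _ (mem_Ioi.1 ha0).ne'), hconst a ha0]
      refine tendsto_nhds_unique hf (tendsto_const_nhds.congr' ?_)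
      filter_upwards [hF self_mem_nhdsWithin] with a ha0
      rw [hconst a ha0, h1, zero_div]
    have hcoeff : ∀ a, 0 < a → est.coeff a = est.coeff 1 := fun a ha =>
      coeff_eq_of_isHomogeneous hom ha
    have hα0 : α = 0 := hzero (fun a => (volume.real (parallelepiped ξ))⁻¹ *
      ((∑ S : Configuration n with S.Nonempty, est.coeff a S) * Real.sin ψ)) 2 two_ne_zero hα
      fun a ha => by simp only [hcoeff a ha]
    have hβ0 : β = 0 := hzero (fun a => -((volume.real (parallelepiped ξ))⁻¹ *
      ∑ S : Configuration n with S.Nonempty, est.coeff a S * perp φ (D S))) 1 one_ne_zero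
      (by simpa only [pow_one] using hβ) fun a ha => by simp only [hcoeff a ha]
    have hγ0 : γ = 0 := hzero (fun a => -((volume.real (parallelepiped ξ))⁻¹ *
      ∑ S : Configuration n with S.Nonempty, est.coeff a S * perp (φ + ψ) (D S))) 1 one_ne_zero
      (by simpa only [pow_one] using hγ) fun a ha => by simp only [hcoeff a ha]
    rw [h s₁ s₂ h₁ h₂, hα0, hβ0, hγ0]
    simp [L₀]
  · have hlim : ∀ φ ψ : ℝ, φ ∈ Ioo p q → φ + ψ ∈ Ioo p q → ψ ∈ Ioo 0 Real.pi →
        Tendsto (fun a => est.cornerForm D a φ (φ + ψ)) F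
          (𝓝 (volume.real (parallelepiped ξ) * Real.sin ψ * L₀ φ ψ)) := by
      intro φ ψ hφ hφψ hψ
      obtain ⟨α, β, γ, -, -, -, hG, -⟩ := key φ ψ hφ hφψ hψ
      have hs := Real.sin_pos_of_mem_Ioo hψ
      refine (hG.const_mul (volume.real (parallelepiped ξ) * Real.sin ψ)).congr fun a => ?_
      field_simp
    rcases eq_zero_or_tendsto_diagonal (est.cornerForm_comm D) (est.sin_mul_cornerForm D) hlim
      with h | ⟨φ, hφ, c, hc, h⟩
    · left
      intro φ ψ hφ hφψ hψ
      simpa [hV.ne', (Real.sin_pos_of_mem_Ioo hψ).ne'] using h φ ψ hφ hφψ hψ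
    · right
      refine ⟨φ, hφ, ?_⟩
      have hpos : ∀ᶠ ψ in 𝓝[>] (0 : ℝ), 0 < Real.sin ψ := by
        filter_upwards [Ioo_mem_nhdsGT Real.pi_pos] with ψ hψ using Real.sin_pos_of_mem_Ioo hψ
      have hsin : Tendsto (fun ψ => (volume.real (parallelepiped ξ) * Real.sin ψ)⁻¹)
          (𝓝[>] 0) atTop := by
        refine Tendsto.inv_tendsto_nhdsGT_zero (tendsto_nhdsWithin_iff.2 ⟨?_, ?_⟩)
        · have hcont : Continuous fun ψ => volume.real (parallelepiped ξ) * Real.sin ψ := by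
            fun_prop
          have := (hcont.tendsto 0).mono_left (nhdsWithin_le_nhds (s := Ioi 0))
          rwa [Real.sin_zero, mul_zero] at this
        · filter_upwards [hpos] with ψ hψ using mul_pos hV hψ
      have heq : (fun ψ => (volume.real (parallelepiped ξ) * Real.sin ψ)⁻¹ *
          (volume.real (parallelepiped ξ) * Real.sin ψ * L₀ φ ψ)) =ᶠ[𝓝[>] 0] L₀ φ := by
        filter_upwards [hpos] with ψ hψ
        rw [inv_mul_cancel_left₀ (mul_pos hV hψ).ne']
      rcases hc.lt_or_gt with hc | hc
      · exact Or.inr ((hsin.atTop_mul_neg hc h).congr' heq)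
      · exact Or.inl ((hsin.atTop_mul_pos hc h).congr' heq)

end LocalEstimator

/-! ### The worst case bias -/

theorem finite_latticeDirections (ξ : Module.Basis (Fin 2) ℝ Plane) (n : ℕ) :
    (latticeDirections ξ n).Finite := by
  refine (((finite_Icc (fun _ : Fin 2 => -(n : ℤ)) (fun _ => (n : ℤ))).image
    fun k => ‖latticePoint ξ k‖⁻¹ • latticePoint ξ k)).subset ?_
  rintro _ ⟨k, hk, -, rfl⟩
  exact ⟨k, ⟨fun i => (hk i).1, fun i => (hk i).2.le⟩, rfl⟩

theorem continuous_unitVector : Continuous unitVector := by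
  unfold unitVector
  fun_prop

theorem injOn_unitVector : InjOn unitVector (Ioo 0 1) := by
  intro θ hθ η hη h
  have hpi := Real.pi_gt_three
  have h0 : Real.cos θ = Real.cos η := by simpa [unitVector] using congrArg (fun x : Plane => x 0) h
  exact Real.injOn_cos ⟨hθ.1.le, by linarith [hθ.2]⟩ ⟨hη.1.le, by linarith [hη.2]⟩ h0

/-- Only finitely many angles in `(0, 1)` give lattice directions, and avoiding a finite set of
directions is an open condition. -/
theorem exists_Ioo_unitVector_notMem (ξ : Module.Basis (Fin 2) ℝ Plane) (n : ℕ) :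
    ∃ p q : ℝ, p < q ∧ ∀ θ ∈ Ioo p q, unitVector θ ∉ latticeDirections ξ n := by
  have hfin := finite_latticeDirections ξ n
  have hinf : (Ioo (0 : ℝ) 1 \ unitVector ⁻¹' latticeDirections ξ n).Nonempty := by
    refine Set.Infinite.nonempty fun h => Ioo_infinite (zero_lt_one' ℝ) ?_
    have h' : (Ioo (0 : ℝ) 1 ∩ unitVector ⁻¹' latticeDirections ξ n).Finite :=
      Set.Finite.of_finite_image (f := unitVector)
        (hfin.subset (by rintro _ ⟨θ, hθ, rfl⟩; exact hθ.2))
        (injOn_unitVector.mono inter_subset_left)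
    rw [← sdiff_union_inter (Ioo (0 : ℝ) 1) (unitVector ⁻¹' latticeDirections ξ n)]
    exact h.union h'
  obtain ⟨θ, -, hθ⟩ := hinf
  have hopen : IsOpen (unitVector ⁻¹' latticeDirections ξ n)ᶜ :=
    (hfin.isClosed.preimage continuous_unitVector).isOpen_compl
  obtain ⟨ε, hε, hball⟩ := Metric.isOpen_iff.1 hopen θ hθ
  rw [Real.ball_eq_Ioo] at hball
  exact ⟨_, _, by linarith, fun η hη => hball hη⟩

namespace LocalEstimator

theorem one_le_worstCaseBias (est : LocalEstimator ξ n) : 1 ≤ est.worstCaseBias := by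
  by_contra! hlt
  -- A bound strictly between the bias and 1 holds for the means themselves once `a` is small, and
  -- `1 - δ > 0` keeps them away from 0.
  obtain ⟨δ', hδ', hδ1⟩ := exists_between hlt
  lift δ' to NNReal using (hδ1.trans ENNReal.one_lt_top).ne
  obtain ⟨δ, hδ⟩ : ∃ δ : ℝ, δ = δ' := ⟨_, rfl⟩
  have hδ1 : δ < 1 := by
    rw [hδ]
    exact_mod_cast hδ1
  have hP : ∀ P : Set Plane, IsConvexPolygon P →
      ∀ᶠ a in 𝓝[>] (0 : ℝ), est.mean a P ∈ Icc (1 - δ) (1 + δ) := by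
    intro P hP
    have h1 : est.asymptoticBias P < δ' :=
      (le_iSup₂ (f := fun P (_ : IsConvexPolygon P) => est.asymptoticBias P) P hP).trans_lt hδ'
    rw [asymptoticBias, intrinsicVolumeZero_eq_one hP.isCompact.isBounded
      (hP.2.mono interior_subset)] at h1
    filter_upwards [eventually_lt_of_limsup_lt h1] with a ha
    rw [div_one, ENNReal.ofReal_lt_coe_iff (abs_nonneg _), ← hδ] at ha
    rw [abs_lt] at ha
    exact ⟨by linarith [ha.1], by linarith [ha.2]⟩
  obtain ⟨p, q, hpq, hdir⟩ := exists_Ioo_unitVector_notMem ξ n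
  -- The means are eventually in a compact interval, so along an ultrafilter they converge for all
  -- polygons at once.
  let U : Ultrafilter ℝ := Ultrafilter.of (𝓝[>] 0)
  have hU : (U : Filter ℝ) ≤ 𝓝[>] 0 := Ultrafilter.of_le _
  have hlim : ∀ P : Set Plane, ∃ l : ℝ, IsConvexPolygon P →
      l ∈ Icc (1 - δ) (1 + δ) ∧ Tendsto (fun a => est.mean a P) U (𝓝 l) := by
    intro P
    by_cases h : IsConvexPolygon P
    · obtain ⟨l, hl, hl'⟩ := isCompact_Icc.ultrafilter_le_nhds (U.map fun a => est.mean a P)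
        (le_principal_iff.2 (hU (hP P h)))
      exact ⟨l, fun _ => ⟨hl, hl'⟩⟩
    · exact ⟨0, fun h' => absurd h' h⟩
  choose l hl using hlim
  have hpoly : ∀ φ ψ s₁ s₂ : ℝ, ψ ∈ Ioo 0 Real.pi → 0 < s₁ → 0 < s₂ →
      IsConvexPolygon (parallelogram φ ψ s₁ s₂) := fun φ ψ s₁ s₂ hψ =>
    isConvexPolygon_parallelogram (Real.sin_pos_of_mem_Ioo hψ)
  obtain ⟨L₀, hL₀, -, hdich⟩ := est.exists_limit_parallelogram hU hdir
    (fun φ ψ s₁ s₂ => l (parallelogram φ ψ s₁ s₂))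
    fun φ ψ s₁ s₂ _ _ hψ h₁ h₂ => (hl _ (hpoly φ ψ s₁ s₂ hψ h₁ h₂)).2
  have hmem : ∀ φ ψ : ℝ, φ ∈ Ioo p q → φ + ψ ∈ Ioo p q → ψ ∈ Ioo 0 Real.pi →
      L₀ φ ψ ∈ Icc (1 - δ) (1 + δ) := by
    intro φ ψ hφ hφψ hψ
    refine isClosed_Icc.mem_of_tendsto (hL₀ φ ψ 1 1 hφ hφψ hψ one_pos one_pos) ?_
    filter_upwards [self_mem_nhdsWithin] with t ht
    have ht' : 0 < t * 1 := by simpa using ht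
    exact (hl _ (hpoly φ ψ _ _ hψ ht' ht')).1
  have hsmall : ∀ φ ∈ Ioo p q, ∀ᶠ ψ in 𝓝[>] (0 : ℝ), L₀ φ ψ ∈ Icc (1 - δ) (1 + δ) := by
    intro φ hφ
    have hpos : 0 < min (q - φ) Real.pi := lt_min (by linarith [hφ.2]) Real.pi_pos
    filter_upwards [Ioo_mem_nhdsGT hpos] with ψ hψ
    have h2 := hψ.2.trans_le (min_le_left _ _)
    exact hmem φ ψ hφ ⟨by linarith [hφ.1, hψ.1], by linarith⟩
      ⟨hψ.1, hψ.2.trans_le (min_le_right _ _)⟩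
  -- The value 0 is excluded by `1 - δ > 0`, and divergence by the bounds `1 - δ` and `1 + δ`.
  rcases hdich with h | ⟨φ, hφ, h | h⟩
  · obtain ⟨d, hd0, hd1, hd2⟩ : ∃ d : ℝ, 0 < d ∧ d ≤ 1 ∧ d ≤ (q - p) / 4 :=
      ⟨min 1 ((q - p) / 4), lt_min one_pos (by linarith), min_le_left _ _, min_le_right _ _⟩
    have h1 : (p + q) / 2 ∈ Ioo p q := ⟨by linarith, by linarith⟩
    have h2 : (p + q) / 2 + d ∈ Ioo p q := ⟨by linarith, by linarith⟩
    have h3 : d ∈ Ioo 0 Real.pi := ⟨hd0, by linarith [Real.pi_gt_three]⟩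
    have h4 := hmem _ _ h1 h2 h3
    rw [h _ _ h1 h2 h3] at h4
    linarith [h4.1]
  · obtain ⟨ψ, h1, h2⟩ := ((hsmall φ hφ).and (h.eventually_gt_atTop (1 + δ))).exists
    exact h2.not_ge h1.2
  · obtain ⟨ψ, h1, h2⟩ := ((hsmall φ hφ).and (h.eventually_lt_atBot (1 - δ))).exists
    exact h2.not_ge h1.1

end LocalEstimator

end Estimator

theorem mainTheorem6 (ξ : Module.Basis (Fin 2) ℝ Plane) (n : ℕ) (est : LocalEstimator ξ n) :
    (∀ a : ℝ, 0 < a → ∀ P : Set Plane, IsConvexPolygon P →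
      IntegrableOn (fun c => est.estimate a c P) (parallelepiped ξ)) ∧
    1 ≤ est.worstCaseBias ∧
    ∀ p q : ℝ, (∀ θ ∈ Ioo p q, unitVector θ ∉ latticeDirections ξ n) →
      ∀ L : ℝ → ℝ → ℝ → ℝ → ℝ,
        (∀ φ ψ s₁ s₂ : ℝ, φ ∈ Ioo p q → φ + ψ ∈ Ioo p q → ψ ∈ Ioo 0 Real.pi → 0 < s₁ → 0 < s₂ →
          Tendsto (fun a : ℝ => est.mean a (parallelogram φ ψ s₁ s₂)) (𝓝[>] 0)
            (𝓝 (L φ ψ s₁ s₂))) →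
        ∃ L₀ : ℝ → ℝ → ℝ,
          (∀ φ ψ s₁ s₂ : ℝ, φ ∈ Ioo p q → φ + ψ ∈ Ioo p q → ψ ∈ Ioo 0 Real.pi → 0 < s₁ → 0 < s₂ →
            Tendsto (fun t : ℝ => L φ ψ (t * s₁) (t * s₂)) (𝓝[>] 0) (𝓝 (L₀ φ ψ))) ∧
          (est.IsHomogeneous 0 →
            ∀ φ ψ s₁ s₂ : ℝ, φ ∈ Ioo p q → φ + ψ ∈ Ioo p q → ψ ∈ Ioo 0 Real.pi →
              0 < s₁ → 0 < s₂ → L φ ψ s₁ s₂ = L₀ φ ψ) ∧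
          ((∀ φ ψ : ℝ, φ ∈ Ioo p q → φ + ψ ∈ Ioo p q → ψ ∈ Ioo 0 Real.pi → L₀ φ ψ = 0) ∨
            ∃ φ ∈ Ioo p q, Tendsto (L₀ φ) (𝓝[>] 0) atTop ∨ Tendsto (L₀ φ) (𝓝[>] 0) atBot) := by
  refine ⟨fun a ha P hP => est.integrableOn_estimate ha hP.isCompact.isBounded
    hP.isCompact.measurableSet, est.one_le_worstCaseBias, fun p q hdir L hL => ?_⟩
  exact est.exists_limit_parallelogram le_rfl hdir L hL
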